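/- Let $T_2$ be the rooted binary tree, whose vertices are the finite words over $\{0,1\}$, let $\operatorname{Aut}(T_2)$ be its automorphism group, let $\Omega=\{0,1,2\}^{\mathbb N}$ and let $\sigma:\Omega\to\Omega$ be the left shift, $\sigma(\omega_1,\omega_2,\dots)=(\omega_2,\omega_3,\dots)$. Let $a\in\operatorname{Aut}(T_2)$ be given by $a(0x)=1x$, $a(1x)=0x$, and for $i,j\in\{0,1,2\}$ let $t_i(j)=1$ if $i=j$ and $t_i(j)=a$ if $i\ne j$. For $\omega=(\omega_1,\omega_2,\dots)\in\Omega$ let $b_\omega,c_\omega,d_\omega\in\operatorname{Aut}(T_2)$ be defined recursively by $$b_\omega(0x)=0\,t_0(\omega_1)(x),\quad b_\omega(1x)=1\,b_{\sigma(\omega)}(x),$$ $$c_\omega(0x)=0\,t_1(\omega_1)(x),\quad c_\omega(1x)=1\,c_{\sigma(\omega)}(x),$$ $$d_\omega(0x)=0\,t_2(\omega_1)(x),\quad d_\omega(1x)=1\,d_{\sigma(\omega)}(x).$$ In the group $\operatorname{Aut}(T_2)^{\Omega}$ of all maps $\Omega\to\operatorname{Aut}(T_2)$ with pointwise multiplication,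 let $A(\omega)=a$, $B(\omega)=b_\omega$, $C(\omega)=c_\omega$, $D(\omega)=d_\omega$, and let $Gr_2=\langle A,B,C,D\rangle$ (the universal Grigorchuk $2$-group). Then $Gr_2$ has exponential growth: if $\rho(n)$ denotes the number of elements of $Gr_2$ that are products of at most $n$ factors from $\{A,B,C,D\}^{\pm1}$, then $\lim_{n\to\infty}\frac{\log\rho(n)}{n}$ exists and is positive, and the same holds for the growth function of $Gr_2$ with respect to every finite generating set. -/

import Mathlib

open Filter Topology

namespace Grig

/-- The automorphism group `Aut(T₂)` of the rooted binary tree `T₂`. The vertices are the finite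
words over `{0, 1}` (`false` is `0`, `true` is `1`), the root is the empty word, and `u` is an
ancestor of `v` iff `u` is a prefix of `v`. -/
def treeAut : Subgroup (Equiv.Perm (List Bool)) where
  carrier := {f | (∀ u, (f u).length = u.length) ∧ ∀ u v, u <+: v ↔ f u <+: f v}
  mul_mem' := by
    rintro f g ⟨hf, hf'⟩ ⟨hg, hg'⟩
    refine ⟨fun u => ?_, fun u v => ?_⟩
    · rw [Equiv.Perm.mul_apply, hf, hg]
    · rw [Equiv.Perm.mul_apply, Equiv.Perm.mul_apply, ← hf', ← hg']
  one_mem' := ⟨fun _ => rfl, fun _ _ => Iff.rfl⟩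
  inv_mem' := by
    rintro f ⟨hf, hf'⟩
    refine ⟨fun u => ?_, fun u v => ?_⟩
    · have h := hf (f.symm u)
      rw [Equiv.apply_symm_apply] at h
      exact h.symm
    · have h := hf' (f.symm u) (f.symm v)
      rw [Equiv.apply_symm_apply, Equiv.apply_symm_apply] at h
      exact h.symm

/-- The parameter space `Ω = {0, 1, 2}^ℕ`; the first letter of `ω` is `ω 0`. -/
abbrev Omega : Type := ℕ → Fin 3

/-- The left shift on `Ω`. -/
def shift (ω : Omega) : Omega := fun n => ω (n + 1)

/-- The flip at the top vertex: `a(0x) = 1x`, `a(1x) = 0x`. -/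
def flipFun : List Bool → List Bool
  | [] => []
  | i :: x => (!i) :: x

/-- For `i = 0, 1, 2` this is the action of `b_ω`, `c_ω`, `d_ω` respectively:
`0x ↦ 0 t_i(ω₁)(x)` and `1x ↦ 1 y`, where `y` is the image of `x` under the corresponding
generator for the shifted sequence; here `t_i(j) = 1` if `i = j` and `t_i(j) = a` otherwise. -/
def dirFun (i : Fin 3) : Omega → List Bool → List Bool
  | _, [] => []
  | ω, false :: x => false :: (if i = ω 0 then x else flipFun x)
  | ω, true :: x => true :: dirFun i (shift ω) x

theorem flipFun_flipFun (x : List Bool) : flipFun (flipFun x) = x := by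
  cases x <;> simp [flipFun]

theorem flipFun_length (x : List Bool) : (flipFun x).length = x.length := by
  cases x <;> simp [flipFun]

theorem flipFun_prefix {u v : List Bool} (h : u <+: v) : flipFun u <+: flipFun v := by
  cases u with
  | nil => simp [flipFun]
  | cons i u =>
    cases v with
    | nil => simp at h
    | cons j v => simpa [flipFun, List.cons_prefix_cons] using h

theorem dirFun_dirFun (i : Fin 3) (ω : Omega) (x : List Bool) :
    dirFun i ω (dirFun i ω x) = x := by
  induction x generalizing ω with
  | nil => simp [dirFun]
  | cons j x ih =>
    cases j
    · by_cases h : i = ω 0 <;> simp [dirFun, h, flipFun_flipFun]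
    · simp [dirFun, ih]

theorem dirFun_length (i : Fin 3) (ω : Omega) (x : List Bool) :
    (dirFun i ω x).length = x.length := by
  induction x generalizing ω with
  | nil => simp [dirFun]
  | cons j x ih =>
    cases j
    · by_cases h : i = ω 0 <;> simp [dirFun, h, flipFun_length]
    · simp [dirFun, ih]

theorem dirFun_prefix (i : Fin 3) (ω : Omega) {u v : List Bool} (h : u <+: v) :
    dirFun i ω u <+: dirFun i ω v := by
  induction u generalizing ω v with
  | nil => simp [dirFun]
  | cons j u ih =>
    cases v with
    | nil => simp at h
    | cons k v =>
      obtain ⟨rfl, hu⟩ := List.cons_prefix_cons.1 h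
      cases j
      · by_cases h' : i = ω 0
        · simpa [dirFun, h', List.cons_prefix_cons] using hu
        · simpa [dirFun, h', List.cons_prefix_cons] using flipFun_prefix hu
      · simpa [dirFun, List.cons_prefix_cons] using ih (shift ω) hu

/-- An involution of the vertex set that preserves levels and prefixes, as an element of
`Aut(T₂)`. -/
def ofInvolution (f : List Bool → List Bool) (hf : Function.Involutive f)
    (hl : ∀ u, (f u).length = u.length) (hp : ∀ u v, u <+: v → f u <+: f v) : treeAut :=
  ⟨hf.toPerm f, hl, fun u v =>
    ⟨hp u v, fun h => by
      have h' := hp _ _ h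
      rwa [Function.Involutive.coe_toPerm, hf u, hf v] at h'⟩⟩

/-- The generator `a ∈ Aut(T₂)`. -/
def a : treeAut :=
  ofInvolution flipFun flipFun_flipFun flipFun_length fun _ _ => flipFun_prefix

/-- The generators `b_ω`, `c_ω`, `d_ω ∈ Aut(T₂)`, for `i = 0, 1, 2` respectively. -/
def dir (i : Fin 3) (ω : Omega) : treeAut :=
  ofInvolution (dirFun i ω) (dirFun_dirFun i ω) (dirFun_length i ω)
    fun _ _ => dirFun_prefix i ω

/-- The element `A` of the group `Aut(T₂)^Ω` of all maps `Ω → Aut(T₂)` (with pointwise product):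
the constant map `a`. -/
def A : Omega → treeAut := fun _ => a

/-- The map `ω ↦ b_ω`. -/
def B : Omega → treeAut := fun ω => dir 0 ω

/-- The map `ω ↦ c_ω`. -/
def C : Omega → treeAut := fun ω => dir 1 ω

/-- The map `ω ↦ d_ω`. -/
def D : Omega → treeAut := fun ω => dir 2 ω

/-- The universal Grigorchuk `2`-group `Gr₂ = ⟨A, B, C, D⟩ ≤ Aut(T₂)^Ω`. -/
def Gr2 : Subgroup (Omega → treeAut) := Subgroup.closure {A, B, C, D}

/-- The generating set `{A, B, C, D}`, as a set of elements of the group `Gr₂`. -/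
def Gr2Generators : Set Gr2 := {g | (g : Omega → treeAut) ∈ ({A, B, C, D} : Set _)}

/-- The ball of radius `n` about the identity in the word metric of a group with respect to `S`:
all products of at most `n` factors, each of which lies in `S` or has its inverse in `S`. -/
def ball {G : Type*} [Group G] (S : Set G) (n : ℕ) : Set G :=
  {g | ∃ l : List G, l.length ≤ n ∧ (∀ s ∈ l, s ∈ S ∨ s⁻¹ ∈ S) ∧ l.prod = g}

/-- The growth function of a group with respect to `S` (meant for finite `S`, when balls are
finite). -/
noncomputable def growth {G : Type*} [Group G] (S : Set G) (n : ℕ) : ℕ := (ball S n).ncard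

/-- Exponential growth with respect to `S`: the limit of `log ρ(n) / n` exists and is positive,
where `ρ` is the growth function with respect to `S`. -/
def HasExpGrowthWrt {G : Type*} [Group G] (S : Set G) : Prop :=
  ∃ L : ℝ, 0 < L ∧ Tendsto (fun n : ℕ => Real.log (growth S n) / n) atTop (𝓝 L)

/-- A group has exponential growth if it is finitely generated and has exponential growth with
respect to every finite generating set. -/
def HasExpGrowth (G : Type*) [Group G] : Prop :=
  Group.FG G ∧ ∀ S : Set G, S.Finite → Subgroup.closure S = ⊤ → HasExpGrowthWrt S

end Grig

namespace Grig

open scoped Pointwise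

/-! ### Word balls, Fekete's lemma and a free-semigroup criterion -/

section Balls

variable {G : Type*} [Group G] {S : Set G}

/-! The elements `CA` and `CAB` freely generate a semigroup, so balls of radius `m * K` contain `2 ^
m` products; submultiplicativity and Fekete's lemma give the limit and its positivity. For freeness,
cancel common letters on the right, so that exactly one of two words of equal length acts first by
`CAB`. At `ω = 0ᵏ111…`, `b_ω` moves only words below the vertex `1ᵏ`, while `c_ω a` brings `1ᵏ` back
to itself only at multiples of `2ᵏ` steps (`two_pow_dvd_of_replicate_prefix`). For large `k` only
the first letter feels `B`: the words act on `1ᵏ00` as the same power of `c_ω a`, applied to `1ᵏ01`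
and `1ᵏ00` respectively (`prod_mul_freePair_ne`). -/

theorem one_mem_ball (n : ℕ) : (1 : G) ∈ ball S n := ⟨[], by simp, by simp, rfl⟩

theorem ball_mono {m n : ℕ} (h : m ≤ n) : ball S m ⊆ ball S n := by
  rintro g ⟨l, hl, hS, rfl⟩
  exact ⟨l, hl.trans h, hS, rfl⟩

theorem mul_mem_ball {m n : ℕ} {g h : G} (hg : g ∈ ball S m) (hh : h ∈ ball S n) :
    g * h ∈ ball S (m + n) := by
  obtain ⟨l, hl, hS, rfl⟩ := hg
  obtain ⟨l', hl', hS', rfl⟩ := hh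
  refine ⟨l ++ l', by simp; omega, fun s hs => ?_, by simp⟩
  exact (List.mem_append.1 hs).elim (hS s) (hS' s)

theorem ball_add_subset (m n : ℕ) : ball S (m + n) ⊆ ball S m * ball S n := by
  rintro g ⟨l, hl, hS, rfl⟩
  refine ⟨(l.take m).prod, ⟨l.take m, by simp, fun s hs => hS s (List.mem_of_mem_take hs), rfl⟩,
    (l.drop m).prod, ⟨l.drop m, by simp; omega, fun s hs => hS s (List.mem_of_mem_drop hs), rfl⟩,
    List.prod_take_mul_prod_drop l m⟩

theorem ball_one_subset : ball S 1 ⊆ {1} ∪ (S ∪ S⁻¹) := by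
  rintro g ⟨l, hl, hS, rfl⟩
  match l, hl, hS with
  | [], _, _ => simp
  | [s], _, hS => simpa using Or.inr (hS s (by simp))

theorem finite_ball (hS : S.Finite) (n : ℕ) : (ball S n).Finite := by
  induction n with
  | zero =>
    refine (Set.finite_singleton (1 : G)).subset ?_
    rintro g ⟨l, hl, -, rfl⟩
    obtain rfl : l = [] := by simpa using hl
    simp
  | succ n ih =>
    have h1 : (ball S 1).Finite :=
      ((Set.finite_singleton 1).union (hS.union hS.inv)).subset ball_one_subset
    exact (ih.mul h1).subset (ball_add_subset n 1)

theorem exists_mem_ball (hS : Subgroup.closure S = ⊤) (g : G) : ∃ n, g ∈ ball S n := by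
  have hg : g ∈ (Subgroup.closure S).toSubmonoid := hS ▸ Subgroup.mem_top g
  rw [Subgroup.closure_toSubmonoid] at hg
  obtain ⟨l, hl, rfl⟩ := Submonoid.exists_list_of_mem_closure hg
  exact ⟨l.length, l, le_rfl, hl, rfl⟩

theorem prod_mem_ball {K : ℕ} (l : List G) (hl : ∀ g ∈ l, g ∈ ball S K) :
    l.prod ∈ ball S (l.length * K) := by
  induction l with
  | nil => exact one_mem_ball _
  | cons g l ih =>
    rw [List.prod_cons, List.length_cons, add_mul, one_mul, add_comm]
    exact mul_mem_ball (hl g (by simp)) (ih fun h hh => hl h (by simp [hh]))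

theorem growth_pos (hS : S.Finite) (n : ℕ) : 0 < growth S n :=
  (Set.ncard_pos (finite_ball hS n)).2 ⟨1, one_mem_ball n⟩

theorem growth_add_le (hS : S.Finite) (m n : ℕ) :
    growth S (m + n) ≤ growth S m * growth S n := by
  refine (Set.ncard_le_ncard (ball_add_subset m n)
    ((finite_ball hS m).mul (finite_ball hS n))).trans ?_
  simpa only [growth, Nat.card_coe_set_eq] using
    Set.natCard_mul_le (s := ball S m) (t := ball S n)

theorem subadditive_log_growth (hS : S.Finite) :
    Subadditive fun n => Real.log (growth S n) := by
  intro m n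
  have hm : (0 : ℝ) < growth S m := by exact_mod_cast growth_pos hS m
  have hn : (0 : ℝ) < growth S n := by exact_mod_cast growth_pos hS n
  have hmn : (0 : ℝ) < growth S (m + n) := by exact_mod_cast growth_pos hS (m + n)
  rw [← Real.log_mul hm.ne' hn.ne']
  exact Real.log_le_log hmn (by exact_mod_cast growth_add_le hS m n)

/-- If balls of radius `m * K` contain at least `2 ^ m` elements, then the growth is exponential. -/
theorem HasExpGrowthWrt.of_two_pow_le (hS : S.Finite) {K : ℕ} (hK : 0 < K)
    (h : ∀ m, 2 ^ m ≤ growth S (m * K)) : HasExpGrowthWrt S := by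
  have hsub := subadditive_log_growth hS
  have hbdd : BddBelow (Set.range fun n : ℕ => Real.log (growth S n) / n) :=
    ⟨0, by rintro _ ⟨n, rfl⟩; positivity⟩
  have hlim := hsub.tendsto_lim hbdd
  have hK' : (0 : ℝ) < K := by exact_mod_cast hK
  refine ⟨hsub.lim, lt_of_lt_of_le (div_pos (Real.log_pos one_lt_two) hK') ?_, hlim⟩
  -- The limit exists by Fekete, so it can be bounded below along the multiples of `K`.
  have hsubseq : Tendsto (fun m : ℕ => m * K) atTop atTop :=
    tendsto_id.atTop_mul_const' hK
  refine ge_of_tendsto (hlim.comp hsubseq) ?_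
  filter_upwards [eventually_gt_atTop 0] with m hm
  have hm' : (0 : ℝ) < m := by exact_mod_cast hm
  have hlog : (m : ℝ) * Real.log 2 ≤ Real.log (growth S (m * K)) := by
    rw [← Real.log_pow]
    exact Real.log_le_log (by positivity) (by exact_mod_cast h m)
  simp only [Function.comp_apply, Nat.cast_mul]
  rw [div_le_div_iff₀ hK' (by positivity)]
  nlinarith [mul_le_mul_of_nonneg_right hlog hK'.le]

/-- A finitely generated group in which two elements freely generate a subsemigroup has
exponential growth. -/
theorem HasExpGrowth.of_free_semigroup (hG : Group.FG G) (f : Bool → G)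
    (hf : ∀ l l' : List Bool, l.length = l'.length → (l.map f).prod = (l'.map f).prod → l = l') :
    HasExpGrowth G := by
  refine ⟨hG, fun S hS hgen => ?_⟩
  obtain ⟨K₀, h₀⟩ := exists_mem_ball hgen (f false)
  obtain ⟨K₁, h₁⟩ := exists_mem_ball hgen (f true)
  have hK : ∀ e, f e ∈ ball S (K₀ + K₁ + 1) := by
    rintro (_ | _)
    · exact ball_mono (by omega) h₀
    · exact ball_mono (by omega) h₁
  refine .of_two_pow_le hS (Nat.succ_pos (K₀ + K₁)) fun m => ?_
  let F : (Fin m → Bool) → G := fun e => ((List.ofFn e).map f).prod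
  have hF : Function.Injective F := fun e e' h =>
    List.ofFn_injective (hf _ _ (by simp) h)
  have hsub : Set.range F ⊆ ball S (m * (K₀ + K₁ + 1)) := by
    rintro _ ⟨e, rfl⟩
    have := prod_mem_ball (S := S) (K := K₀ + K₁ + 1) ((List.ofFn e).map f)
      (by simpa using fun i => hK (e i))
    rwa [List.length_map, List.length_ofFn] at this
  calc 2 ^ m = (Set.range F).ncard := by
        rw [← Set.image_univ, Set.ncard_image_of_injective _ hF, Set.ncard_univ]; simp
    _ ≤ growth S (m * (K₀ + K₁ + 1)) := Set.ncard_le_ncard hsub (finite_ball hS _)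

end Balls

/-! ### Dynamics at the sequences `0ᵏ111…` -/

/-- The sequence `0ᵏ111…`. -/
def zerosThenOnes (k : ℕ) : Omega := fun n => if n < k then 0 else 1

theorem shift_zerosThenOnes (k : ℕ) : shift (zerosThenOnes (k + 1)) = zerosThenOnes k := by
  ext n; simp [shift, zerosThenOnes]

theorem zerosThenOnes_succ_zero (k : ℕ) : zerosThenOnes (k + 1) 0 = 0 := by
  simp [zerosThenOnes]

/-- `b_ω` with `ω = 0ᵏ111…` acts trivially outside the subtree at `1ᵏ`. -/
theorem dirFun_zero_eq_self {k : ℕ} {x : List Bool} (h : ¬ List.replicate k true <+: x) :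
    dirFun 0 (zerosThenOnes k) x = x := by
  induction k generalizing x with
  | zero => simp at h
  | succ k ih =>
    match x with
    | [] => rfl
    | false :: x => simp [dirFun, zerosThenOnes_succ_zero]
    | true :: x =>
      rw [dirFun, shift_zerosThenOnes, ih]
      simpa [List.replicate_succ, List.cons_prefix_cons] using h

theorem dirFun_zero_replicate (k : ℕ) :
    dirFun 0 (zerosThenOnes k) (List.replicate k true ++ [false, false]) =
      List.replicate k true ++ [false, true] := by
  induction k with
  | zero => simp [dirFun, zerosThenOnes, flipFun]
  | succ k ih => simpa [List.replicate_succ, dirFun, shift_zerosThenOnes] using ih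

/-- The action of `c_ω a` with `ω = 0ᵏ111…`. -/
def dihedralStep (k : ℕ) (x : List Bool) : List Bool :=
  dirFun 1 (zerosThenOnes k) (flipFun x)

theorem dihedralStep_injective (k : ℕ) : Function.Injective (dihedralStep k) :=
  (Function.LeftInverse.injective (dirFun_dirFun 1 _)).comp
    (Function.LeftInverse.injective flipFun_flipFun)

/-- Odometer self-similarity: the flip swaps the two halves of the tree, and `c_ω` flips below `0`
since `1 ≠ ω₁ = 0`, so the square of the step restricts to the step one level down. -/
theorem dihedralStep_iterate_two_mul (k i : ℕ) (x : List Bool) :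
    (dihedralStep (k + 1))^[2 * i] (true :: x) = true :: (dihedralStep k)^[i] x := by
  induction i generalizing x with
  | zero => rfl
  | succ i ih =>
    rw [mul_add, mul_one, Function.iterate_add_apply, Function.iterate_succ_apply (dihedralStep k),
      ← ih]
    simp [dihedralStep, flipFun, dirFun, zerosThenOnes_succ_zero, shift_zerosThenOnes]

theorem two_pow_dvd_of_replicate_prefix {k j : ℕ} {y : List Bool}
    (h : List.replicate k true <+: (dihedralStep k)^[j] (List.replicate k true ++ y)) :
    2 ^ k ∣ j := by
  induction k generalizing j with
  | zero => simp
  | succ k ih =>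
    rw [List.replicate_succ, List.cons_append] at h
    obtain ⟨i, rfl | rfl⟩ := j.even_or_odd'
    · rw [dihedralStep_iterate_two_mul, List.cons_prefix_cons] at h
      rw [pow_succ']
      exact mul_dvd_mul_left 2 (ih h.2)
    -- An odd number of steps ends in the subtree at `0`.
    · rw [Function.iterate_succ_apply', dihedralStep_iterate_two_mul] at h
      simp [dihedralStep, flipFun, dirFun, List.cons_prefix_cons] at h

/-! ### Freeness of the semigroup generated by `CA` and `CAB` -/

/-- The elements `CA` and `CAB` of `Gr₂`. -/
def freePair (e : Bool) : Gr2 :=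
  ⟨if e then C * A * B else C * A, by
    have hA : A ∈ Gr2 := Subgroup.subset_closure (by simp)
    have hB : B ∈ Gr2 := Subgroup.subset_closure (by simp)
    have hC : C ∈ Gr2 := Subgroup.subset_closure (by simp)
    split_ifs
    · exact mul_mem (mul_mem hC hA) hB
    · exact mul_mem hC hA⟩

/-- The action of an element of `Gr₂` on words through its coordinate at `0ᵏ111…`. -/
def evalAt (k : ℕ) (g : Gr2) (x : List Bool) : List Bool :=
  ((g : Omega → treeAut) (zerosThenOnes k) : Equiv.Perm (List Bool)) x

theorem evalAt_mul (k : ℕ) (g h : Gr2) (x : List Bool) :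
    evalAt k (g * h) x = evalAt k g (evalAt k h x) := rfl

theorem evalAt_freePair_false (k : ℕ) (x : List Bool) :
    evalAt k (freePair false) x = dihedralStep k x := rfl

theorem evalAt_freePair_true (k : ℕ) (x : List Bool) :
    evalAt k (freePair true) x = dihedralStep k (dirFun 0 (zerosThenOnes k) x) := rfl

/-- Every `B` meets a word after between `1` and `2ᵏ - 1` steps, away from `1ᵏ`, and so does
nothing. Lists are reversed because the rightmost factor acts first. -/
theorem evalAt_prod_iterate {k j : ℕ} (l : List Bool) (y : List Bool) (hj : 0 < j)
    (hl : j + l.length ≤ 2 ^ k) :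
    evalAt k (l.reverse.map freePair).prod
        ((dihedralStep k)^[j] (List.replicate k true ++ y)) =
      (dihedralStep k)^[j + l.length] (List.replicate k true ++ y) := by
  induction l generalizing j with
  | nil => rfl
  | cons e l ih =>
    have hfix : dirFun 0 (zerosThenOnes k) ((dihedralStep k)^[j] (List.replicate k true ++ y)) =
        (dihedralStep k)^[j] (List.replicate k true ++ y) := by
      refine dirFun_zero_eq_self fun h => ?_
      have := Nat.le_of_dvd hj (two_pow_dvd_of_replicate_prefix h)
      simp only [List.length_cons] at hl
      omega
    have hstep : evalAt k (freePair e) ((dihedralStep k)^[j] (List.replicate k true ++ y)) =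
        (dihedralStep k)^[j + 1] (List.replicate k true ++ y) := by
      rw [Function.iterate_succ_apply']
      cases e
      · rw [evalAt_freePair_false]
      · rw [evalAt_freePair_true, hfix]
    simp only [List.length_cons] at hl ⊢
    rw [List.reverse_cons, List.map_append, List.prod_append, List.map_singleton,
      List.prod_singleton, evalAt_mul, hstep, ih (Nat.succ_pos j) (by omega)]
    congr 1
    omega

theorem prod_mul_freePair_ne (l l' : List Bool) (h : l.length = l'.length) :
    (l.reverse.map freePair).prod * freePair true ≠
      (l'.reverse.map freePair).prod * freePair false := by
  intro heq
  -- The orbit must not return to `1ᵏ` before the last letter acts; the `1` counts the first letter.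
  obtain ⟨k, hk⟩ : ∃ k, 1 + l.length ≤ 2 ^ k := ⟨_, Nat.lt_two_pow_self.le⟩
  have h1 := congrArg (fun g => evalAt k g (List.replicate k true ++ [false, false])) heq
  simp only [evalAt_mul, evalAt_freePair_false, evalAt_freePair_true, dirFun_zero_replicate] at h1
  have h2 := evalAt_prod_iterate l [false, true] one_pos hk
  have h3 := evalAt_prod_iterate l' [false, false] one_pos (h ▸ hk)
  rw [Function.iterate_one] at h2 h3
  rw [h2, h3, h] at h1
  simpa using (dihedralStep_injective k).iterate _ h1

theorem prod_reverse_freePair_injective (l l' : List Bool) (h : l.length = l'.length)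
    (heq : (l.reverse.map freePair).prod = (l'.reverse.map freePair).prod) : l = l' := by
  induction l generalizing l' with
  | nil => exact (List.length_eq_zero_iff.1 h.symm).symm
  | cons e l ih =>
    match l' with
    | e' :: l' =>
      have hlen : l.length = l'.length := by simpa using h
      simp only [List.reverse_cons, List.map_append, List.prod_append, List.map_singleton,
        List.prod_singleton] at heq
      rcases e with _ | _ <;> rcases e' with _ | _
      · rw [ih l' hlen (mul_right_cancel heq)]
      · exact (prod_mul_freePair_ne l' l hlen.symm heq.symm).elim
      · exact (prod_mul_freePair_ne l l' hlen heq).elim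
      · rw [ih l' hlen (mul_right_cancel heq)]

theorem closure_Gr2Generators : Subgroup.closure Gr2Generators = ⊤ :=
  Subgroup.closure_closure_coe_preimage

theorem finite_Gr2Generators : Gr2Generators.Finite :=
  Set.Finite.preimage Subtype.coe_injective.injOn
    (Set.toFinite ({A, B, C, D} : Set (Omega → treeAut)))

theorem hasExpGrowth_Gr2 : HasExpGrowth Gr2 :=
  .of_free_semigroup (Group.fg_iff.2 ⟨_, closure_Gr2Generators, finite_Gr2Generators⟩) freePair
    fun l l' h heq => List.reverse_injective <|
      prod_reverse_freePair_injective _ _ (by simpa using h) (by simpa using heq)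

end Grig

theorem mainTheorem2 :
    Subgroup.closure Grig.Gr2Generators = ⊤ ∧
      Grig.HasExpGrowthWrt Grig.Gr2Generators ∧
      Grig.HasExpGrowth Grig.Gr2 :=
  ⟨Grig.closure_Gr2Generators,
    Grig.hasExpGrowth_Gr2.2 _ Grig.finite_Gr2Generators Grig.closure_Gr2Generators,
    Grig.hasExpGrowth_Gr2⟩
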